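/- Let $t\ge 1$ be an integer, let $\eta>0$, and let $a_0,\dots,a_{t-1}$ be real numbers with $a_{t-1}>0$. Then there are $X>0$ and $\varepsilon_0\in(0,e^{-1})$ such that for every $\varepsilon\in(0,\varepsilon_0)$ the equation $$\varepsilon=\sum_{k=0}^{t-1}a_k\,x^{-\eta}(\log x)^k$$ has exactly one solution $x=x_0(\varepsilon)$ in $(X,\infty)$. Put $$\tilde x_0(\varepsilon):=\left[\frac{a_{t-1}}{\eta^{t-1}}\cdot\frac1\varepsilon\cdot\left(\log\frac1\varepsilon\right)^{t-1}\right]^{1/\eta}.$$ Here $X$ and $\varepsilon_0$ can be chosen so that there are real numbers $\tilde d_{rs}$ ($r,s\ge 0$), not depending on $\varepsilon$, with $\tilde d_{00}=0$ such that for all $\varepsilon\in(0,\varepsilon_0)$ $$x_0=\tilde x_0\left[1+\sum_{r=0}^\infty\sum_{s=0}^\infty\tilde d_{rs}\left(\log\log\frac1\varepsilon\right)^s\left(\log\frac1\varepsilon\right)^{-(r+s)}\right],$$ where the double series converges absolutely and uniformly (as does the series of absolute values) on $(0,\varepsilon_0)$. The rearranged series $$\sum_{\ell=1}^\infty\sum_{s=0}^{\ell}\tilde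 d_{\ell-s,s}\left(\log\log\frac1\varepsilon\right)^s\left(\log\frac1\varepsilon\right)^{-\ell}$$ converges to $(x_0/\tilde x_0)-1$ on $(0,\varepsilon_0)$ and is a complete asymptotic expansion of it as $\varepsilon\to0+$: if the terms are ordered by increasing $\ell$ and, for equal $\ell$, by decreasing $s$, then for all $\ell\ge1$ and $0\le s\le\ell$ the error in truncating the series just after the term with index $(\ell,s)$ is $o\big((\log\log\frac1\varepsilon)^s(\log\frac1\varepsilon)^{-\ell}\big)$. The coefficient of the lead term $(\log\log\frac1\varepsilon)(\log\frac1\varepsilon)^{-1}$ is $\tilde d_{01}=(t-1)^2/\eta$. -/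

import Mathlib

open Filter Topology Asymptotics

noncomputable section

/-- The function `f(x) = ∑_{k < t} a_k x^{-η} (log x)^k` (used for `x > 0` only). -/
def logPowerSum (t : ℕ) (η : ℝ) (a : ℕ → ℝ) (x : ℝ) : ℝ :=
  ∑ k ∈ Finset.range t, a k * x ^ (-η) * Real.log x ^ k

/-- The lead-order approximant
`x̃₀(ε) = [ (a_{t-1} / η^{t-1}) * (1/ε) * (log (1/ε))^{t-1} ]^{1/η}` (used for `t ≥ 1` only). -/
def leadApprox (t : ℕ) (η : ℝ) (a : ℕ → ℝ) (ε : ℝ) : ℝ :=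
  (a (t - 1) / η ^ (t - 1) * (1 / ε) * Real.log (1 / ε) ^ (t - 1)) ^ (1 / η)

/-- The scale function `(log log (1/ε))^s (log (1/ε))^{-ℓ}`. -/
def logScale (ℓ s : ℕ) (ε : ℝ) : ℝ :=
  Real.log (Real.log (1 / ε)) ^ s / Real.log (1 / ε) ^ ℓ

/-- The block of order `ℓ` of the rearranged series,
`∑_{s=0}^{ℓ} d_{ℓ-s,s} (log log (1/ε))^s (log (1/ε))^{-ℓ}`. -/
def logBlock (d : ℕ → ℕ → ℝ) (ℓ : ℕ) (ε : ℝ) : ℝ :=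
  ∑ s ∈ Finset.range (ℓ + 1), d (ℓ - s) s * logScale ℓ s ε

/-- The rearranged series `∑_{ℓ ≥ 1} ∑_{s=0}^{ℓ} d_{ℓ-s,s} (log log (1/ε))^s (log (1/ε))^{-ℓ}`
is a complete asymptotic expansion of `g` as `ε → 0+`, in the sense of Poincaré.
The terms are ordered by decreasing size of the scale functions as `ε → 0+`
(`ℓ` increasing and, for equal `ℓ`, `s` decreasing); for every `(ℓ, s)`, the error in truncating
the series just after the term with index `(ℓ, s)` is `o` of the scale function of that index. -/
def IsCompleteLogExpansion (g : ℝ → ℝ) (d : ℕ → ℕ → ℝ) : Prop :=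
  ∀ ℓ : ℕ, 1 ≤ ℓ → ∀ s : ℕ, s ≤ ℓ →
    (fun ε : ℝ => g ε - (∑ j ∈ Finset.Ico 1 ℓ, logBlock d j ε
        + ∑ i ∈ Finset.Icc s ℓ, d (ℓ - i) i * logScale ℓ i ε))
      =o[𝓝[>] (0 : ℝ)] (fun ε : ℝ => logScale ℓ s ε)

end

/-! Put `L = log (1/ε)`, `M = log L`, `u = 1/L`, `v = M/L`, `c = log (a_{t-1}/η^{t-1})`, and write
the unknown as `x = x̃₀ e^z`. Then `log x = (L/η) y` with `y = 1 + (t-1)v + cu + ηuz`, and the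
equation becomes `e^{ηz} = P(u, y)` for a polynomial `P` with `P(0, y) = y^{t-1}`. Large and small
quantities now enter only through `(u, v) → (0, 0)`. At the origin `z = 0` is a solution and the
`z`-derivative is `η ≠ 0`, so the analytic implicit function theorem gives `z = z(u, v)`
(`exists_analytic_implicit_log`).

The double power series of `e^z - 1` has coefficients bounded by `C K^(r+s)`
(`AnalyticAt.exists_bivariate_series`). A geometric majorant independent of `ε` then yields absolute
and uniform convergence, and regrouping by total degree yields the asymptotic expansion. The
solution built this way is the only large one because the sum is eventually strictly decreasing
(`exists_strictAntiOn_logPowerSum`). -/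

/-! ### Double power series of analytic functions of two variables. -/

theorem hasSum_sum_antidiagonal_of_summable {f : ℕ × ℕ → ℝ} (hf : Summable f) :
    HasSum (fun n : ℕ => ∑ q ∈ Finset.HasAntidiagonal.antidiagonal n, f q) (∑' q, f q) := by
  have h := (Finset.HasAntidiagonal.sigmaAntidiagonalEquivProd (A := ℕ)).hasSum_iff.2 hf.hasSum
  have h2 := h.sigma (fun n => (Finset.HasAntidiagonal.antidiagonal n).hasSum f)
  exact h2

theorem summable_geometric_add {K : ℝ} (h0 : 0 ≤ K) (h1 : K < 1) :
    Summable (fun q : ℕ × ℕ => K ^ (q.1 + q.2)) := by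
  have := (summable_geometric_of_lt_one h0 h1).mul_of_nonneg (summable_geometric_of_lt_one h0 h1)
    (fun n => pow_nonneg h0 n) (fun n => pow_nonneg h0 n)
  simpa [pow_add] using this

/-- A coefficient bound `C K^(r+s)` gives a geometric bound on the terms of the double series. -/
theorem abs_coeff_mul_monomial_le {d : ℕ → ℕ → ℝ} {C K δ u v : ℝ} (hC : 0 ≤ C)
    (hd : ∀ r s, |d r s| ≤ C * K ^ (r + s)) (hK : 0 ≤ K) (hu : |u| ≤ δ) (hv : |v| ≤ δ)
    (q : ℕ × ℕ) : |d q.1 q.2 * (u ^ q.1 * v ^ q.2)| ≤ C * (K * δ) ^ (q.1 + q.2) := by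
  have hδ : 0 ≤ δ := (abs_nonneg u).trans hu
  rw [abs_mul, abs_mul, abs_pow, abs_pow]
  calc |d q.1 q.2| * (|u| ^ q.1 * |v| ^ q.2)
      ≤ (C * K ^ (q.1 + q.2)) * (δ ^ q.1 * δ ^ q.2) := by
        gcongr
        exact hd _ _
    _ = C * (K * δ) ^ (q.1 + q.2) := by rw [mul_pow, ← pow_add]; ring

/-- The coefficient of `u ^ r * v ^ (n - r)` in the `n`-th term of a power series on `ℝ × ℝ`. -/
noncomputable def bivariateCoeff (p : FormalMultilinearSeries ℝ (ℝ × ℝ) ℝ) (n r : ℕ) : ℝ :=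
  ∑ S ∈ Finset.powersetCard r (Finset.univ : Finset (Fin n)),
    p n (S.piecewise (fun _ => (1, 0)) (fun _ => (0, 1)))

/-- The coefficient sums over some of the `2 ^ n` subsets, and the basis vectors have sup norm 1. -/
theorem abs_bivariateCoeff_le (p : FormalMultilinearSeries ℝ (ℝ × ℝ) ℝ) (n r : ℕ) :
    |bivariateCoeff p n r| ≤ 2 ^ n * ‖p n‖ := by
  have hterm : ∀ S : Finset (Fin n),
      |p n (S.piecewise (fun _ => (1, 0)) (fun _ => (0, 1)))| ≤ ‖p n‖ := by
    intro S
    have h := (p n).le_opNorm (S.piecewise (fun _ => ((1 : ℝ), (0 : ℝ))) (fun _ => (0, 1)))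
    rw [Real.norm_eq_abs] at h
    refine h.trans (mul_le_of_le_one_right (norm_nonneg _) ?_)
    refine Finset.prod_le_one (fun i _ => norm_nonneg _) (fun i _ => ?_)
    by_cases hi : i ∈ S <;> simp [hi, Prod.norm_def]
  calc |bivariateCoeff p n r|
      ≤ ∑ S ∈ Finset.powersetCard r (Finset.univ : Finset (Fin n)), ‖p n‖ :=
        (Finset.abs_sum_le_sum_abs _ _).trans (Finset.sum_le_sum fun S _ => hterm S)
    _ ≤ ∑ S : Finset (Fin n), ‖p n‖ :=
        Finset.sum_le_sum_of_subset_of_nonneg (Finset.subset_univ _) fun _ _ _ => norm_nonneg _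
    _ = 2 ^ n * ‖p n‖ := by simp

/-- Expand `(u, v) = (u, 0) + (0, v)` by multilinearity and group the subsets of slots by
cardinality. -/
theorem apply_eq_sum_bivariateCoeff (p : FormalMultilinearSeries ℝ (ℝ × ℝ) ℝ) (n : ℕ) (u v : ℝ) :
    p n (fun _ => (u, v)) = ∑ q ∈ Finset.HasAntidiagonal.antidiagonal n,
      bivariateCoeff p (q.1 + q.2) q.1 * (u ^ q.1 * v ^ q.2) := by
  have h1 : p n (fun _ => (u, v)) = ∑ S : Finset (Fin n), u ^ S.card * v ^ (n - S.card) *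
      p n (S.piecewise (fun _ => (1, 0)) (fun _ => (0, 1))) := by
    have := (p n).map_add_univ (fun _ => ((u, 0) : ℝ × ℝ)) (fun _ => ((0, v) : ℝ × ℝ))
    have h0 : ((fun _ => ((u, 0) : ℝ × ℝ)) + (fun _ => ((0, v) : ℝ × ℝ)) : Fin n → ℝ × ℝ) =
        fun _ => (u, v) := by ext <;> simp
    rw [h0] at this
    rw [this]
    refine Finset.sum_congr rfl fun S _ => ?_
    have h2 : (S.piecewise (fun _ => ((u, 0) : ℝ × ℝ)) (fun _ => (0, v)) : Fin n → ℝ × ℝ) =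
        fun i => (S.piecewise (fun _ => u) (fun _ => v) : Fin n → ℝ) i •
          (S.piecewise (fun _ => ((1, 0) : ℝ × ℝ)) (fun _ => (0, 1)) : Fin n → ℝ × ℝ) i := by
      funext i
      by_cases hi : i ∈ S <;> simp [hi]
    rw [h2, (p n).map_smul_univ, smul_eq_mul]
    congr 1
    rw [Finset.prod_piecewise]
    simp [Finset.card_sdiff_of_subset (Finset.subset_univ S)]
  rw [h1, Finset.Nat.sum_antidiagonal_eq_sum_range_succ_mk, ← Finset.powerset_univ,
    Finset.sum_powerset]
  simp only [Finset.card_univ, Fintype.card_fin]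
  refine Finset.sum_congr rfl fun r hr => ?_
  have hrn : r + (n - r) = n := by have := Finset.mem_range.1 hr; omega
  simp only [hrn]
  rw [bivariateCoeff, Finset.sum_mul]
  refine Finset.sum_congr rfl fun S hS => ?_
  rw [(Finset.mem_powersetCard.1 hS).2]
  ring

/-- A function analytic at the origin of `ℝ × ℝ` is the sum of a double power series. -/
theorem AnalyticAt.exists_bivariate_series {f : ℝ × ℝ → ℝ} (hf : AnalyticAt ℝ f 0) :
    ∃ (d : ℕ → ℕ → ℝ) (C K : ℝ), 0 < C ∧ 0 < K ∧ (∀ r s, |d r s| ≤ C * K ^ (r + s)) ∧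
      d 0 0 = f 0 ∧ d 0 1 = fderiv ℝ f 0 (0, 1) ∧
      ∀ᶠ p : ℝ × ℝ in 𝓝 0, f p = ∑' q : ℕ × ℕ, d q.1 q.2 * (p.1 ^ q.1 * p.2 ^ q.2) := by
  obtain ⟨p, hp⟩ := hf
  obtain ⟨C, R, hC, hR, hpn⟩ := p.le_mul_pow_of_radius_pos hp.radius_pos
  have hd : ∀ r s, |bivariateCoeff p (r + s) r| ≤ C * (2 * R) ^ (r + s) := by
    intro r s
    refine (abs_bivariateCoeff_le p _ _).trans ?_
    calc 2 ^ (r + s) * ‖p (r + s)‖ ≤ 2 ^ (r + s) * (C * R ^ (r + s)) := by gcongr; exact hpn _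
      _ = _ := by rw [mul_pow]; ring
  refine ⟨fun r s => bivariateCoeff p (r + s) r, C, 2 * R, hC, by positivity, hd, ?_, ?_, ?_⟩
  · rw [← hp.coeff_zero (fun _ => (0, 0))]
    rw [apply_eq_sum_bivariateCoeff]
    simp
  · rw [hp.fderiv_eq]
    rw [continuousMultilinearCurryFin1_apply]
    have : p 1 (Fin.snoc 0 ((0 : ℝ), (1 : ℝ))) = p 1 (fun _ => (0, 1)) := by
      congr 1
    rw [this, apply_eq_sum_bivariateCoeff]
    simp [Finset.Nat.antidiagonal_succ]
  · have hsum := hp.eventually_hasSum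
    -- The coefficients grow at most like `(2R)^n`, so this radius gives ratio 1/2.
    have hball : ∀ᶠ y : ℝ × ℝ in 𝓝 0, ‖y‖ ≤ 1 / (4 * R) := by
      have : Metric.closedBall (0 : ℝ × ℝ) (1 / (4 * R)) ∈ 𝓝 0 :=
        Metric.closedBall_mem_nhds _ (by positivity)
      filter_upwards [this] with y hy
      simpa using hy
    filter_upwards [hsum, hball] with y hy hyR
    have hu : |y.1| ≤ 1 / (4 * R) := (norm_fst_le y).trans hyR
    have hv : |y.2| ≤ 1 / (4 * R) := (norm_snd_le y).trans hyR
    have hS : Summable fun q : ℕ × ℕ =>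
        bivariateCoeff p (q.1 + q.2) q.1 * (y.1 ^ q.1 * y.2 ^ q.2) := by
      refine Summable.of_norm_bounded (g := fun q => C * (1 / 2) ^ (q.1 + q.2))
        ((summable_geometric_add (by norm_num) (by norm_num)).mul_left C) fun q => ?_
      have := abs_coeff_mul_monomial_le (d := fun r s => bivariateCoeff p (r + s) r)
        hC.le hd (by positivity) hu hv q
      rw [Real.norm_eq_abs]
      refine this.trans_eq ?_
      congr 2
      field_simp
      norm_num
    rw [zero_add] at hy
    refine hy.unique ?_
    refine (hasSum_sum_antidiagonal_of_summable hS).congr_fun fun n => ?_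
    exact apply_eq_sum_bivariateCoeff p n y.1 y.2

/-! ### The implicit equation for `log (x₀ / x̃₀)`. -/

/-- The polynomial `∑_{k<t} (a_k / a_{t-1}) (η u)^{t-1-k} y^k`, a rescaling of
`∑_{k<t} a_k (log x)^k`. -/
noncomputable def scaledPoly (t : ℕ) (η : ℝ) (a : ℕ → ℝ) (u y : ℝ) : ℝ :=
  ∑ k ∈ Finset.range t, a k / a (t - 1) * (η * u) ^ (t - 1 - k) * y ^ k

theorem scaledPoly_zero {t : ℕ} (ht : 1 ≤ t) (η : ℝ) {a : ℕ → ℝ} (ha : a (t - 1) ≠ 0) (y : ℝ) :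
    scaledPoly t η a 0 y = y ^ (t - 1) := by
  rw [scaledPoly, Finset.sum_eq_single (t - 1)]
  · simp [div_self ha]
  · intro k hk hne
    have : t - 1 - k ≠ 0 := by have := Finset.mem_range.1 hk; omega
    simp [this]
  · intro h
    exact absurd (Finset.mem_range.2 (by omega)) h

theorem ContinuousLinearMap.isInvertible_of_apply_one_ne_zero {f : ℝ →L[ℝ] ℝ} (h : f 1 ≠ 0) :
    f.IsInvertible :=
  ⟨ContinuousLinearEquiv.unitsEquivAut ℝ (Units.mk0 _ h), by ext; simp⟩

open scoped ContDiff in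
/-- The logarithm of `x₀ / x̃₀` is an analytic function of `1 / log (1/ε)` and
`log log (1/ε) / log (1/ε)`, defined by an implicit equation. -/
theorem exists_analytic_implicit_log {t : ℕ} (ht : 1 ≤ t) {η : ℝ} (hη : 0 < η) {a : ℕ → ℝ}
    (ha : a (t - 1) ≠ 0) (c : ℝ) :
    ∃ z : ℝ × ℝ → ℝ, AnalyticAt ℝ z 0 ∧ z 0 = 0 ∧
      fderiv ℝ z 0 (0, 1) = ((t : ℝ) - 1) ^ 2 / η ∧
      ∀ᶠ p : ℝ × ℝ in 𝓝 0, Real.exp (η * z p) =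
        scaledPoly t η a p.1 (1 + ((t : ℝ) - 1) * p.2 + c * p.1 + η * p.1 * z p) := by
  set F : (ℝ × ℝ) × ℝ → ℝ := fun q => Real.exp (η * q.2) -
    scaledPoly t η a q.1.1 (1 + ((t : ℝ) - 1) * q.1.2 + c * q.1.1 + η * q.1.1 * q.2) with hF
  have hcd : ContDiffAt ℝ ω F 0 := by
    simp only [hF, scaledPoly]
    fun_prop
  have hF0 : F 0 = 0 := by simp [hF, scaledPoly_zero ht η ha]
  have hinv : (fderiv ℝ F 0 ∘L .inr ℝ (ℝ × ℝ) ℝ).IsInvertible := by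
    apply ContinuousLinearMap.isInvertible_of_apply_one_ne_zero
    have h1 : HasDerivAt (fun z : ℝ => F (0, z)) (fderiv ℝ F 0 (0, 1)) 0 := by
      have hd : HasFDerivAt F (fderiv ℝ F 0) ((0 : ℝ × ℝ), (0 : ℝ)) :=
        (hcd.differentiableAt (by simp)).hasFDerivAt
      exact hd.comp_hasDerivAt (0 : ℝ) ((hasDerivAt_const (0 : ℝ) (0 : ℝ × ℝ)).prodMk
        (hasDerivAt_id (0 : ℝ)))
    have h2 : HasDerivAt (fun z : ℝ => F (0, z)) η 0 := by
      have h3 : (fun z : ℝ => F (0, z)) = fun z => Real.exp (η * z) - 1 := by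
        funext z
        simp [hF, scaledPoly_zero ht η ha]
      rw [h3]
      have := (((hasDerivAt_id (0 : ℝ)).const_mul η).exp).sub_const 1
      simpa using this
    have h4 := h1.unique h2
    simp [h4, hη.ne']
  set z := hcd.implicitFunction (by simp) hinv with hz
  have hz0 : z 0 = 0 := hcd.implicitFunction_apply_self (by simp) hinv
  have hza : AnalyticAt ℝ z 0 := (hcd.contDiffAt_implicitFunction (by simp) hinv).analyticAt
  have heq : ∀ᶠ p : ℝ × ℝ in 𝓝 0, Real.exp (η * z p) =
      scaledPoly t η a p.1 (1 + ((t : ℝ) - 1) * p.2 + c * p.1 + η * p.1 * z p) := by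
    filter_upwards [hcd.eventually_apply_implicitFunction (by simp) hinv] with p hp
    rw [hF0] at hp
    exact sub_eq_zero.1 hp
  refine ⟨z, hza, hz0, ?_, heq⟩
  have hzd : HasDerivAt (fun v : ℝ => z (0, v)) (fderiv ℝ z 0 (0, 1)) 0 := by
    have hd : HasFDerivAt z (fderiv ℝ z 0) ((0 : ℝ), (0 : ℝ)) :=
      hza.differentiableAt.hasFDerivAt
    exact hd.comp_hasDerivAt (0 : ℝ) ((hasDerivAt_const (0 : ℝ) (0 : ℝ)).prodMk
      (hasDerivAt_id (0 : ℝ)))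
  -- Along `u = 0` the equation is `e^{ηz} = (1 + (t-1)v)^{t-1}`; differentiating both sides at `v =
  -- 0` gives `∂z/∂v`.
  have h1 : HasDerivAt (fun v : ℝ => Real.exp (η * z (0, v))) (η * fderiv ℝ z 0 (0, 1)) 0 := by
    have := (hzd.const_mul η).exp
    have h00 : z ((0 : ℝ), (0 : ℝ)) = 0 := hz0
    simpa [h00] using this
  have h2 : HasDerivAt (fun v : ℝ => Real.exp (η * z (0, v))) (((t : ℝ) - 1) ^ 2) 0 := by
    have h3 : HasDerivAt (fun v : ℝ => (1 + ((t : ℝ) - 1) * v) ^ (t - 1))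
        (((t : ℝ) - 1) ^ 2) 0 := by
      have := ((((hasDerivAt_id (0 : ℝ)).const_mul ((t : ℝ) - 1)).const_add 1).pow (t - 1))
      have hc : ((t - 1 : ℕ) : ℝ) = (t : ℝ) - 1 := by push_cast [ht]; ring
      refine this.congr_deriv ?_
      simp [hc, sq]
    refine h3.congr_of_eventuallyEq ?_
    have hcont : Tendsto (fun v : ℝ => ((0 : ℝ), v)) (𝓝 0) (𝓝 0) :=
      (by fun_prop : Continuous fun v : ℝ => ((0 : ℝ), v)).tendsto' _ _ rfl
    filter_upwards [hcont.eventually heq] with v hv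
    rw [hv]
    simp [scaledPoly_zero ht η ha]
  rw [eq_div_iff hη.ne', mul_comm]
  exact h1.unique h2

/-! ### Eventual monotonicity. -/

/-- With `A(s) = ∑ a_k s^k`, the derivative is `x^{-η-1} (A' - ηA)(log x)`. It is eventually
negative since `A` is eventually positive and `A'/A → 0 < η`. -/
theorem exists_strictAntiOn_logPowerSum {t : ℕ} (ht : 1 ≤ t) {η : ℝ} (hη : 0 < η) {a : ℕ → ℝ}
    (ha : 0 < a (t - 1)) : ∃ X : ℝ, 0 < X ∧ StrictAntiOn (logPowerSum t η a) (Set.Ioi X) := by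
  set A : Polynomial ℝ := ∑ k ∈ Finset.range t, Polynomial.monomial k (a k) with hA
  have hcoeff : A.coeff (t - 1) = a (t - 1) := by
    simp [hA, Polynomial.finsetSum_coeff, Polynomial.coeff_monomial]
    omega
  have hdegle : A.natDegree ≤ t - 1 := by
    refine Polynomial.natDegree_sum_le_of_forall_le _ _ fun k hk => ?_
    have := Finset.mem_range.1 hk
    exact (Polynomial.natDegree_monomial_le _).trans (by omega)
  have hdeg : A.natDegree = t - 1 :=
    Polynomial.natDegree_eq_of_le_of_coeff_ne_zero hdegle (by rw [hcoeff]; exact ha.ne')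
  have hA0 : A ≠ 0 := fun h => ha.ne' (by rw [← hcoeff, h, Polynomial.coeff_zero])
  have hlead : A.leadingCoeff = a (t - 1) := by rw [Polynomial.leadingCoeff, hdeg, hcoeff]
  have hf : ∀ x, logPowerSum t η a x = x ^ (-η) * A.eval (Real.log x) := by
    intro x
    simp only [logPowerSum, hA, Polynomial.eval_finsetSum, Polynomial.eval_monomial,
      Finset.mul_sum]
    exact Finset.sum_congr rfl fun k _ => by ring
  have hpos : ∀ᶠ s in atTop, 0 < A.eval s := by
    have h1 := Polynomial.div_tendsto_atTop_leadingCoeff_div_of_degree_eq A (Polynomial.X ^ (t - 1))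
      (by rw [Polynomial.degree_X_pow, Polynomial.degree_eq_natDegree hA0, hdeg])
    have h2 : 0 < A.leadingCoeff / (Polynomial.X ^ (t - 1) : Polynomial ℝ).leadingCoeff := by
      simpa [hlead] using ha
    filter_upwards [h1.eventually_const_lt h2, eventually_gt_atTop 0] with s hs hs0
    have : 0 < (Polynomial.X ^ (t - 1) : Polynomial ℝ).eval s := by simp; positivity
    exact (div_pos_iff_of_pos_right this).1 hs
  have hneg : ∀ᶠ s in atTop, A.derivative.eval s - η * A.eval s < 0 := by
    have h1 := Polynomial.div_tendsto_atTop_zero_of_degree_lt A.derivative A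
      (Polynomial.degree_derivative_lt hA0)
    filter_upwards [h1.eventually_lt_const hη, hpos] with s hs hs0
    rw [div_lt_iff₀ hs0] at hs
    linarith
  obtain ⟨X, hX⟩ := (Real.tendsto_log_atTop.eventually hneg).exists_forall_of_atTop
  refine ⟨max X 1, by positivity, ?_⟩
  have hder : ∀ x : ℝ, 0 < x → HasDerivAt (logPowerSum t η a)
      (x ^ (-η - 1) * (A.derivative.eval (Real.log x) - η * A.eval (Real.log x))) x := by
    intro x hx
    have h1 := Real.hasDerivAt_rpow_const (x := x) (p := -η) (Or.inl hx.ne')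
    have h2 := (A.hasDerivAt (Real.log x)).comp x (Real.hasDerivAt_log hx.ne')
    have h3 := h1.mul h2
    have h4 : logPowerSum t η a = fun x => x ^ (-η) * A.eval (Real.log x) := funext hf
    rw [h4]
    refine h3.congr_deriv ?_
    rw [Real.rpow_sub_one hx.ne']
    simp only [Function.comp]
    ring
  have hpos' : ∀ x ∈ Set.Ioi (max X 1), 0 < x := fun x hx =>
    lt_trans one_pos ((le_max_right _ _).trans_lt hx)
  refine strictAntiOn_of_deriv_neg (convex_Ioi _)
    (fun x hx => (hder x (hpos' x hx)).continuousAt.continuousWithinAt) fun x hx => ?_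
  rw [interior_Ioi] at hx
  rw [(hder x (hpos' x hx)).deriv]
  exact mul_neg_of_pos_of_neg (Real.rpow_pos_of_pos (hpos' x hx) _)
    (hX x ((le_max_left _ _).trans (le_of_lt hx)))

/-! ### Scale functions and the rearranged series. -/

theorem logScale_add_eq {ε : ℝ} (h : Real.log (1 / ε) ≠ 0) (r s : ℕ) :
    logScale (r + s) s ε =
      (Real.log (1 / ε))⁻¹ ^ r * (Real.log (Real.log (1 / ε)) / Real.log (1 / ε)) ^ s := by
  rw [logScale, pow_add, div_pow, inv_pow]
  field_simp

theorem logBlock_eq_sum_antidiagonal (d : ℕ → ℕ → ℝ) (ℓ : ℕ) (ε : ℝ) :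
    logBlock d ℓ ε = ∑ q ∈ Finset.HasAntidiagonal.antidiagonal ℓ,
      d q.1 q.2 * logScale (q.1 + q.2) q.2 ε := by
  rw [← Finset.Nat.sum_antidiagonal_swap, Finset.Nat.sum_antidiagonal_eq_sum_range_succ_mk,
    logBlock]
  refine Finset.sum_congr rfl fun s hs => ?_
  have hs' : ℓ - s + s = ℓ := by have := Finset.mem_range.1 hs; omega
  simp only [Prod.swap_prod_mk]
  rw [hs']

theorem tendsto_log_one_div : Tendsto (fun ε : ℝ => Real.log (1 / ε)) (𝓝[>] 0) atTop := by
  simpa only [one_div, Function.comp_def] using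
    Real.tendsto_log_atTop.comp (tendsto_inv_nhdsGT_zero (𝕜 := ℝ))

theorem tendsto_loglog_one_div :
    Tendsto (fun ε : ℝ => Real.log (Real.log (1 / ε))) (𝓝[>] 0) atTop :=
  Real.tendsto_log_atTop.comp tendsto_log_one_div

theorem tendsto_loglog_pow_div_log (n : ℕ) :
    Tendsto (fun ε : ℝ => Real.log (Real.log (1 / ε)) ^ n / Real.log (1 / ε)) (𝓝[>] 0) (𝓝 0) :=
  (Real.isLittleO_pow_log_id_atTop (n := n)).tendsto_div_nhds_zero.comp tendsto_log_one_div

theorem logScale_isLittleO_of_lt (ℓ : ℕ) {i s : ℕ} (h : i < s) :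
    logScale ℓ i =o[𝓝[>] 0] logScale ℓ s := by
  have h1 := (isLittleO_pow_pow_atTop_of_lt (𝕜 := ℝ) h).comp_tendsto tendsto_loglog_one_div
  have h2 := h1.mul_isBigO (isBigO_refl (fun ε : ℝ => (Real.log (1 / ε) ^ ℓ)⁻¹) (𝓝[>] 0))
  exact h2

/-- As `M ≥ 1`, each `M ^ s` in the block is at most `M ^ ℓ`; the number of terms `ℓ + 1` is
absorbed by `2 ^ ℓ`. -/
theorem abs_logBlock_le {d : ℕ → ℕ → ℝ} {C K : ℝ} (hC : 0 ≤ C) (hK : 0 ≤ K)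
    (hd : ∀ r s, |d r s| ≤ C * K ^ (r + s)) {ε : ℝ} (hL : 0 < Real.log (1 / ε))
    (hM : 1 ≤ Real.log (Real.log (1 / ε))) (ℓ : ℕ) :
    |logBlock d ℓ ε| ≤
      C * (2 * K * (Real.log (Real.log (1 / ε)) / Real.log (1 / ε))) ^ ℓ := by
  set L := Real.log (1 / ε) with hLdef
  set M := Real.log L
  have hterm : ∀ s ∈ Finset.range (ℓ + 1), |d (ℓ - s) s * logScale ℓ s ε| ≤
      C * (K * (M / L)) ^ ℓ := by
    intro s hs
    have hsl : s ≤ ℓ := Nat.lt_succ_iff.1 (Finset.mem_range.1 hs)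
    have h1 := hd (ℓ - s) s
    rw [Nat.sub_add_cancel hsl] at h1
    have h2 : |logScale ℓ s ε| ≤ (M / L) ^ ℓ := by
      rw [logScale, ← hLdef, abs_of_nonneg (by positivity), div_pow]
      gcongr
    rw [abs_mul, mul_pow, ← mul_assoc]
    gcongr
  calc |logBlock d ℓ ε| ≤ ∑ s ∈ Finset.range (ℓ + 1), C * (K * (M / L)) ^ ℓ :=
        (Finset.abs_sum_le_sum_abs _ _).trans (Finset.sum_le_sum hterm)
    _ = ((ℓ + 1 : ℕ) : ℝ) * (C * (K * (M / L)) ^ ℓ) := by simp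
    _ ≤ 2 ^ ℓ * (C * (K * (M / L)) ^ ℓ) := by
        gcongr
        exact_mod_cast (Nat.lt_two_pow_self : ℓ < 2 ^ ℓ)
    _ = C * (2 * K * (M / L)) ^ ℓ := by rw [mul_assoc 2, mul_pow 2]; ring

/-- Once `2Kv ≤ 1/2`, the tail is dominated by a geometric series and is `O(v^{ℓ+1})`. Since
`v^{ℓ+1} = (M^{ℓ+1}/L) L^{-ℓ}`, this is `o(L^{-ℓ})`, hence negligible against every scale of order
`ℓ`. -/
theorem tail_logBlock_isLittleO {d : ℕ → ℕ → ℝ} {C K : ℝ} (hC : 0 ≤ C) (hK : 0 ≤ K)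
    (hd : ∀ r s, |d r s| ≤ C * K ^ (r + s)) {g : ℝ → ℝ}
    (hg : ∀ᶠ ε in 𝓝[>] (0 : ℝ), HasSum (fun ℓ : ℕ => logBlock d (ℓ + 1) ε) (g ε)) (ℓ s : ℕ) :
    (fun ε => g ε - ∑ j ∈ Finset.Ico 1 (ℓ + 1), logBlock d j ε) =o[𝓝[>] (0 : ℝ)]
      logScale ℓ s := by
  have hv : ∀ᶠ ε in 𝓝[>] (0 : ℝ),
      2 * K * (Real.log (Real.log (1 / ε)) / Real.log (1 / ε)) ≤ 1 / 2 := by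
    have h := (tendsto_loglog_pow_div_log 1).const_mul (2 * K)
    rw [mul_zero] at h
    filter_upwards [h.eventually_lt_const (by norm_num : (0 : ℝ) < 1 / 2)] with ε hε
    simpa using hε.le
  have hbound : (fun ε => g ε - ∑ j ∈ Finset.Ico 1 (ℓ + 1), logBlock d j ε) =O[𝓝[>] (0 : ℝ)]
      fun ε => (Real.log (Real.log (1 / ε)) / Real.log (1 / ε)) ^ (ℓ + 1) := by
    refine IsBigO.of_bound (C * (2 * K) ^ (ℓ + 1) * 2) ?_
    filter_upwards [hg, hv, tendsto_log_one_div.eventually_gt_atTop 0,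
      tendsto_loglog_one_div.eventually_ge_atTop 1] with ε hε hvε hL hM
    set v := Real.log (Real.log (1 / ε)) / Real.log (1 / ε)
    have hv0 : 0 ≤ v := by positivity
    have hsum := (hasSum_nat_add_iff' ℓ).2 hε
    have h1 : ∑ j ∈ Finset.Ico 1 (ℓ + 1), logBlock d j ε =
        ∑ i ∈ Finset.range ℓ, logBlock d (i + 1) ε := by
      rw [Finset.sum_Ico_eq_sum_range]
      simp [add_comm]
    rw [h1, ← hsum.tsum_eq]
    have hgeo : HasSum (fun j : ℕ => C * (2 * K * v) ^ (ℓ + 1) * (1 / 2) ^ j)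
        (C * (2 * K * v) ^ (ℓ + 1) * 2) := hasSum_geometric_two.mul_left _
    refine (tsum_of_norm_bounded hgeo fun j => ?_).trans (le_of_eq ?_)
    · rw [Real.norm_eq_abs]
      refine (abs_logBlock_le hC hK hd hL hM _).trans ?_
      have h2 : j + ℓ + 1 = (ℓ + 1) + j := by ring
      rw [h2, pow_add, ← mul_assoc]
      gcongr
    · rw [Real.norm_of_nonneg (pow_nonneg hv0 _), mul_pow]
      ring
  refine hbound.trans_isLittleO ?_
  have h3 : (fun ε => (Real.log (Real.log (1 / ε)) / Real.log (1 / ε)) ^ (ℓ + 1)) =o[𝓝[>] (0 : ℝ)]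
      fun ε => (Real.log (1 / ε) ^ ℓ)⁻¹ := by
    have h4 := (isLittleO_one_iff ℝ).2 (tendsto_loglog_pow_div_log (ℓ + 1))
    have h5 := h4.mul_isBigO
      (isBigO_refl (fun ε : ℝ => (Real.log (1 / ε) ^ ℓ)⁻¹) (𝓝[>] 0))
    refine h5.congr (fun ε => ?_) (fun ε => one_mul _)
    rw [div_pow, pow_succ (Real.log (1 / ε)) ℓ, div_mul_eq_mul_div, ← div_eq_mul_inv, div_div]
  refine h3.trans_isBigO (IsBigO.of_bound 1 ?_)
  filter_upwards [tendsto_log_one_div.eventually_gt_atTop 0,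
      tendsto_loglog_one_div.eventually_ge_atTop 1] with ε hL hM
  rw [one_mul, logScale, div_eq_mul_inv (Real.log (Real.log (1 / ε)) ^ s), norm_mul]
  refine le_mul_of_one_le_left (norm_nonneg _) ?_
  rw [norm_pow]
  exact one_le_pow₀ (hM.trans (le_abs_self _))

theorem isCompleteLogExpansion_of_hasSum {d : ℕ → ℕ → ℝ} {C K : ℝ} (hC : 0 ≤ C) (hK : 0 ≤ K)
    (hd : ∀ r s, |d r s| ≤ C * K ^ (r + s)) {g : ℝ → ℝ}
    (hg : ∀ᶠ ε in 𝓝[>] (0 : ℝ), HasSum (fun ℓ : ℕ => logBlock d (ℓ + 1) ε) (g ε)) :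
    IsCompleteLogExpansion g d := by
  intro ℓ hℓ s hs
  have h1 := tail_logBlock_isLittleO hC hK hd hg ℓ s
  -- The truncation also omits the terms of block `ℓ` with index below `s`, which carry lower powers
  -- of `M`.
  have h2 : (fun ε => ∑ i ∈ Finset.range s, d (ℓ - i) i * logScale ℓ i ε) =o[𝓝[>] (0 : ℝ)]
      logScale ℓ s :=
    IsLittleO.fun_sum fun i hi =>
      (logScale_isLittleO_of_lt ℓ (Finset.mem_range.1 hi)).const_mul_left _
  refine (h1.add h2).congr_left fun ε => ?_
  have h3 : logBlock d ℓ ε = ∑ i ∈ Finset.range s, d (ℓ - i) i * logScale ℓ i ε +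
      ∑ i ∈ Finset.Icc s ℓ, d (ℓ - i) i * logScale ℓ i ε := by
    rw [logBlock, ← Finset.sum_range_add_sum_Ico _ (by omega : s ≤ ℓ + 1)]
    rfl
  rw [Finset.sum_Ico_succ_top hℓ, h3]
  ring

/-! ### Passing from the implicit equation back to the original one. -/

theorem log_leadApprox_base {t : ℕ} (ht : 1 ≤ t) {η : ℝ} (hη : 0 < η) {a : ℕ → ℝ}
    (ha : 0 < a (t - 1)) {ε : ℝ} (hε : 0 < ε) (hL : 0 < Real.log (1 / ε)) :
    Real.log (a (t - 1) / η ^ (t - 1) * (1 / ε) * Real.log (1 / ε) ^ (t - 1)) =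
      Real.log (a (t - 1) / η ^ (t - 1)) + Real.log (1 / ε) +
        ((t : ℝ) - 1) * Real.log (Real.log (1 / ε)) := by
  rw [Real.log_mul (by positivity) (by positivity), Real.log_mul (by positivity) (by positivity),
    Real.log_pow]
  push_cast [ht]
  ring

theorem leadApprox_pos {t : ℕ} {η : ℝ} (hη : 0 < η) {a : ℕ → ℝ} (ha : 0 < a (t - 1)) {ε : ℝ}
    (hε : 0 < ε) (hL : 0 < Real.log (1 / ε)) : 0 < leadApprox t η a ε :=
  Real.rpow_pos_of_pos (by positivity) _

theorem log_leadApprox_mul_exp {t : ℕ} (ht : 1 ≤ t) {η : ℝ} (hη : 0 < η) {a : ℕ → ℝ}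
    (ha : 0 < a (t - 1)) {ε : ℝ} (hε : 0 < ε) (hL : 0 < Real.log (1 / ε)) (z : ℝ) :
    Real.log (leadApprox t η a ε * Real.exp z) =
      1 / η * (Real.log (a (t - 1) / η ^ (t - 1)) + Real.log (1 / ε) +
        ((t : ℝ) - 1) * Real.log (Real.log (1 / ε))) + z := by
  rw [Real.log_mul (leadApprox_pos hη ha hε hL).ne' (Real.exp_pos z).ne', Real.log_exp, leadApprox,
    Real.log_rpow (by positivity), log_leadApprox_base ht hη ha hε hL]

theorem logPowerSum_leadApprox_mul_exp {t : ℕ} (ht : 1 ≤ t) {η : ℝ} (hη : 0 < η) {a : ℕ → ℝ}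
    (ha : 0 < a (t - 1)) {ε : ℝ} (hε : 0 < ε) (hL : 0 < Real.log (1 / ε)) {z : ℝ}
    (hz : Real.exp (η * z) = scaledPoly t η a (Real.log (1 / ε))⁻¹
      (1 + ((t : ℝ) - 1) * (Real.log (Real.log (1 / ε)) / Real.log (1 / ε)) +
        Real.log (a (t - 1) / η ^ (t - 1)) * (Real.log (1 / ε))⁻¹ +
        η * (Real.log (1 / ε))⁻¹ * z)) :
    logPowerSum t η a (leadApprox t η a ε * Real.exp z) = ε := by
  have hlog := log_leadApprox_mul_exp ht hη ha hε hL z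
  have hpow : (leadApprox t η a ε * Real.exp z) ^ (-η) =
      (a (t - 1) / η ^ (t - 1) * (1 / ε) * Real.log (1 / ε) ^ (t - 1))⁻¹ *
        (Real.exp (η * z))⁻¹ := by
    rw [Real.mul_rpow (leadApprox_pos hη ha hε hL).le (Real.exp_pos z).le, leadApprox,
      ← Real.rpow_mul (by positivity), ← Real.exp_mul, ← Real.exp_neg]
    have h1 : 1 / η * -η = -1 := by field_simp
    rw [h1, Real.rpow_neg_one]
    congr 2
    ring
  set L := Real.log (1 / ε) with hLdef
  set M := Real.log L
  set c := Real.log (a (t - 1) / η ^ (t - 1))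
  set y := 1 + ((t : ℝ) - 1) * (M / L) + c * L⁻¹ + η * L⁻¹ * z with hy
  have hlog' : Real.log (leadApprox t η a ε * Real.exp z) = L / η * y := by
    rw [hlog, hy]
    field_simp
    ring
  have hsum : ∑ k ∈ Finset.range t, a k * (L / η * y) ^ k =
      a (t - 1) * (L / η) ^ (t - 1) * scaledPoly t η a L⁻¹ y := by
    rw [scaledPoly, Finset.mul_sum]
    refine Finset.sum_congr rfl fun k hk => ?_
    have hk' : t - 1 = k + (t - 1 - k) := by have := Finset.mem_range.1 hk; omega
    -- `ηu` is the inverse of `L/η`, so the powers of `ηu` in the scaled polynomial restore the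
    -- lower powers of `log x`.
    have h1 : (L / η) ^ (t - 1) * (η * L⁻¹) ^ (t - 1 - k) = (L / η) ^ k := by
      conv_lhs => rw [hk']
      rw [pow_add, Nat.add_sub_cancel_left, mul_assoc, ← mul_pow]
      have : L / η * (η * L⁻¹) = 1 := by field_simp
      rw [this, one_pow, mul_one]
    calc a k * (L / η * y) ^ k = a k * ((L / η) ^ (t - 1) * (η * L⁻¹) ^ (t - 1 - k)) * y ^ k := by
          rw [h1, mul_pow]; ring
      _ = _ := by
          field_simp
  have hfac : logPowerSum t η a (leadApprox t η a ε * Real.exp z) =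
      (leadApprox t η a ε * Real.exp z) ^ (-η) *
        ∑ k ∈ Finset.range t, a k * (L / η * y) ^ k := by
    rw [logPowerSum, hlog', Finset.mul_sum]
    exact Finset.sum_congr rfl fun k _ => by ring
  rw [hfac, hpow, hsum, ← hz, div_pow]
  have := (Real.exp_pos (η * z)).ne'
  field_simp

theorem eventually_lt_leadApprox_mul_exp {t : ℕ} (ht : 1 ≤ t) {η : ℝ} (hη : 0 < η) {a : ℕ → ℝ}
    (ha : 0 < a (t - 1)) {X : ℝ} (hX : 0 < X) :
    ∀ᶠ ε in 𝓝[>] (0 : ℝ), ∀ z : ℝ, -1 ≤ z → X < leadApprox t η a ε * Real.exp z := by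
  set c := Real.log (a (t - 1) / η ^ (t - 1)) with hc
  filter_upwards [self_mem_nhdsWithin,
    -- This threshold is `log X < (c + L)/η - 1` solved for `L`, the `-1` being the worst case of
    -- `z`.
    tendsto_log_one_div.eventually_gt_atTop (max 0 (η * (Real.log X + 1) - c)),
    tendsto_loglog_one_div.eventually_ge_atTop 0] with ε hε hL hM z hz
  have hL0 : 0 < Real.log (1 / ε) := (le_max_left _ _).trans_lt hL
  have hL1 := (le_max_right _ _).trans_lt hL
  have ht' : (0 : ℝ) ≤ (t : ℝ) - 1 := by
    have : (1 : ℝ) ≤ t := by exact_mod_cast ht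
    linarith
  rw [← Real.log_lt_log_iff hX (mul_pos (leadApprox_pos hη ha hε hL0) (Real.exp_pos z)),
    log_leadApprox_mul_exp ht hη ha hε hL0 z, ← hc]
  have h1 : Real.log X + 1 < 1 / η * (c + Real.log (1 / ε) +
      ((t : ℝ) - 1) * Real.log (Real.log (1 / ε))) := by
    rw [one_div_mul_eq_div, lt_div_iff₀ hη]
    have := mul_nonneg ht' hM
    nlinarith
  linarith

/-! ### Assembly. -/

theorem lemma4p4 (t : ℕ) (ht : 1 ≤ t) (η : ℝ) (hη : 0 < η) (a : ℕ → ℝ) (ha : 0 < a (t - 1)) :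
    ∃ (X ε₀ : ℝ) (d : ℕ → ℕ → ℝ), 0 < X ∧ 0 < ε₀ ∧ ε₀ < Real.exp (-1) ∧
      -- for small `ε`, the equation has exactly one large solution
      (∀ ε ∈ Set.Ioo 0 ε₀, ∃! x : ℝ, X < x ∧ logPowerSum t η a x = ε) ∧
      d 0 0 = 0 ∧
      d 0 1 = ((t : ℝ) - 1) ^ 2 / η ∧
      ∀ x₀ : ℝ → ℝ, (∀ ε ∈ Set.Ioo 0 ε₀, X < x₀ ε ∧ logPowerSum t η a (x₀ ε) = ε) →
        -- the expansion, with absolute convergence of the double series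
        (∀ ε ∈ Set.Ioo 0 ε₀,
          Summable (fun p : ℕ × ℕ => |d p.1 p.2 * logScale (p.1 + p.2) p.2 ε|) ∧
          x₀ ε = leadApprox t η a ε *
            (1 + ∑' p : ℕ × ℕ, d p.1 p.2 * logScale (p.1 + p.2) p.2 ε)) ∧
        -- uniform convergence, of the series of absolute values and of the series itself
        TendstoUniformlyOn
          (fun (S : Finset (ℕ × ℕ)) (ε : ℝ) =>
            ∑ p ∈ S, |d p.1 p.2 * logScale (p.1 + p.2) p.2 ε|)
          (fun ε => ∑' p : ℕ × ℕ, |d p.1 p.2 * logScale (p.1 + p.2) p.2 ε|)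
          atTop (Set.Ioo 0 ε₀) ∧
        TendstoUniformlyOn
          (fun (S : Finset (ℕ × ℕ)) (ε : ℝ) => ∑ p ∈ S, d p.1 p.2 * logScale (p.1 + p.2) p.2 ε)
          (fun ε => x₀ ε / leadApprox t η a ε - 1)
          atTop (Set.Ioo 0 ε₀) ∧
        -- the rearranged series converges to the same sum and is a complete asymptotic expansion
        (∀ ε ∈ Set.Ioo 0 ε₀,
          HasSum (fun ℓ : ℕ => logBlock d (ℓ + 1) ε) (x₀ ε / leadApprox t η a ε - 1)) ∧
        IsCompleteLogExpansion (fun ε => x₀ ε / leadApprox t η a ε - 1) d := by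
  obtain ⟨X, hX0, hX⟩ := exists_strictAntiOn_logPowerSum ht hη ha
  set c := Real.log (a (t - 1) / η ^ (t - 1)) with hc
  obtain ⟨z, hza, hz0, hz1, hzeq⟩ := exists_analytic_implicit_log ht hη ha.ne' c
  have hWa : AnalyticAt ℝ (fun p => Real.exp (z p) - 1) 0 := hza.rexp.sub analyticAt_const
  obtain ⟨d, C, K, hC, hK, hd, hd0, hd1, hW⟩ := hWa.exists_bivariate_series
  have hfd : fderiv ℝ (fun p => Real.exp (z p) - 1) 0 = fderiv ℝ z 0 := by
    have := (hza.differentiableAt.hasFDerivAt.exp).sub_const 1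
    rw [hz0, Real.exp_zero, one_smul] at this
    exact this.fderiv
  have huv : Tendsto (fun ε : ℝ => ((Real.log (1 / ε))⁻¹,
      Real.log (Real.log (1 / ε)) / Real.log (1 / ε))) (𝓝[>] 0) (𝓝 (0 : ℝ × ℝ)) := by
    have h1 : Tendsto (fun ε : ℝ => (Real.log (1 / ε))⁻¹) (𝓝[>] 0) (𝓝 0) :=
      tendsto_inv_atTop_zero.comp tendsto_log_one_div
    have h2 := tendsto_loglog_pow_div_log 1
    simp only [pow_one] at h2
    exact h1.prodMk_nhds h2
  -- This radius makes the majorant `C (1/2)^(r+s)`, uniformly in `ε`.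
  have hδ : ∀ᶠ p : ℝ × ℝ in 𝓝 0, ‖p‖ ≤ 1 / (2 * K) := by
    filter_upwards [Metric.closedBall_mem_nhds (0 : ℝ × ℝ)
      (by positivity : 0 < 1 / (2 * K))] with y hy
    simpa using hy
  have hzm : ∀ᶠ p : ℝ × ℝ in 𝓝 0, -1 ≤ z p :=
    (hza.continuousAt.eventually_const_lt (by rw [hz0]; norm_num)).mono fun _ h => le_of_lt h
  have hev : ∀ᶠ ε in 𝓝[>] (0 : ℝ), 0 < Real.log (1 / ε) ∧
      (∀ z : ℝ, -1 ≤ z → X < leadApprox t η a ε * Real.exp z) ∧ _ :=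
    (tendsto_log_one_div.eventually_gt_atTop 0).and
      ((eventually_lt_leadApprox_mul_exp ht hη ha hX0).and
        (huv.eventually (hzeq.and (hW.and (hδ.and hzm)))))
  obtain ⟨ε₁, hε₁, hsub⟩ := mem_nhdsGT_iff_exists_Ioo_subset.1 hev
  have hε₁' : (0 : ℝ) < ε₁ := hε₁
  set u : ℝ → ℝ := fun ε => (Real.log (1 / ε))⁻¹ with hu
  set v : ℝ → ℝ := fun ε => Real.log (Real.log (1 / ε)) / Real.log (1 / ε) with hv
  set ε₀ := min ε₁ (Real.exp (-1) / 2) with hε₀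
  have hgood : ∀ ε ∈ Set.Ioo 0 ε₀, 0 < Real.log (1 / ε) ∧
      X < leadApprox t η a ε * Real.exp (z (u ε, v ε)) ∧
      logPowerSum t η a (leadApprox t η a ε * Real.exp (z (u ε, v ε))) = ε ∧
      Real.exp (z (u ε, v ε)) - 1 = ∑' q : ℕ × ℕ, d q.1 q.2 * logScale (q.1 + q.2) q.2 ε ∧
      ∀ q : ℕ × ℕ, |d q.1 q.2 * logScale (q.1 + q.2) q.2 ε| ≤ C * (1 / 2) ^ (q.1 + q.2) := by
    intro ε hε
    obtain ⟨hL, hbig, hz, hser, hnorm, hzε⟩ :=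
      hsub ⟨hε.1, hε.2.trans_le (min_le_left _ _)⟩
    refine ⟨hL, hbig _ hzε, logPowerSum_leadApprox_mul_exp ht hη ha hε.1 hL hz, ?_, fun q => ?_⟩
    · simp only [logScale_add_eq hL.ne']
      exact hser
    · rw [logScale_add_eq hL.ne']
      have := abs_coeff_mul_monomial_le hC.le hd hK.le ((norm_fst_le _).trans hnorm)
        ((norm_snd_le _).trans hnorm) q
      refine this.trans_eq ?_
      congr 2
      field_simp
  have hsumm : Summable fun q : ℕ × ℕ => C * (1 / 2 : ℝ) ^ (q.1 + q.2) :=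
    (summable_geometric_add (by norm_num) (by norm_num)).mul_left C
  have hε₀pos : 0 < ε₀ := lt_min hε₁' (by positivity)
  refine ⟨X, ε₀, d, hX0, hε₀pos, (min_le_right _ _).trans_lt (half_lt_self (Real.exp_pos _)),
    fun ε hε => ?_, by rw [hd0, hz0]; simp, by rw [hd1, hfd, hz1], fun x₀ hx₀ => ?_⟩
  · obtain ⟨-, hlt, heq, -, -⟩ := hgood ε hε
    exact ⟨_, ⟨hlt, heq⟩, fun y hy => hX.injOn hy.1 hlt (hy.2.trans heq.symm)⟩
  have hx₀eq : ∀ ε ∈ Set.Ioo 0 ε₀,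
      x₀ ε = leadApprox t η a ε * Real.exp (z (u ε, v ε)) := fun ε hε =>
    hX.injOn (hx₀ ε hε).1 (hgood ε hε).2.1 ((hx₀ ε hε).2.trans (hgood ε hε).2.2.1.symm)
  have hratio : ∀ ε ∈ Set.Ioo 0 ε₀, x₀ ε / leadApprox t η a ε - 1 =
      ∑' q : ℕ × ℕ, d q.1 q.2 * logScale (q.1 + q.2) q.2 ε := fun ε hε => by
    rw [hx₀eq ε hε, mul_div_cancel_left₀ _ (leadApprox_pos hη ha hε.1 (hgood ε hε).1).ne']
    exact (hgood ε hε).2.2.2.1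
  have habs : ∀ ε ∈ Set.Ioo 0 ε₀,
      Summable fun q : ℕ × ℕ => |d q.1 q.2 * logScale (q.1 + q.2) q.2 ε| := fun ε hε =>
    hsumm.of_nonneg_of_le (fun _ => abs_nonneg _) (hgood ε hε).2.2.2.2
  have hblock : ∀ ε ∈ Set.Ioo 0 ε₀,
      HasSum (fun ℓ : ℕ => logBlock d (ℓ + 1) ε) (x₀ ε / leadApprox t η a ε - 1) := by
    intro ε hε
    have h1 := hasSum_sum_antidiagonal_of_summable (habs ε hε).of_abs
    simp only [← logBlock_eq_sum_antidiagonal] at h1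
    -- The block of order 0 is `d 0 0 = 0`, so dropping it leaves the sum unchanged.
    have h2 := (hasSum_nat_add_iff' 1).2 h1
    have h3 : d 0 0 = 0 := by rw [hd0, hz0]; simp
    rw [hratio ε hε]
    simpa [logBlock, h3] using h2
  refine ⟨fun ε hε => ⟨habs ε hε, ?_⟩, ?_, ?_, hblock, ?_⟩
  · rw [← (hgood ε hε).2.2.2.1, hx₀eq ε hε]
    ring
  · refine tendstoUniformlyOn_tsum hsumm fun q ε hε => ?_
    rw [Real.norm_eq_abs, abs_abs]
    exact (hgood ε hε).2.2.2.2 q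
  · refine (tendstoUniformlyOn_tsum hsumm fun q ε hε => ?_).congr_right
      fun ε hε => (hratio ε hε).symm
    exact (hgood ε hε).2.2.2.2 q
  · exact isCompleteLogExpansion_of_hasSum hC.le hK.le hd
      (Filter.mem_of_superset (Ioo_mem_nhdsGT hε₀pos) hblock)
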